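/- Let $V$ be a complex vector space. An $\operatorname{End}V$-valued field is a series $a(z)=\sum_{n\in\mathbb Z}a_{(n)}z^{-n-1}$ with $a_{(n)}\in\operatorname{End}V$ such that for each $v\in V$ one has $a_{(n)}v=0$ for $n\gg0$. For $n\in\mathbb Z$ the $n$-th product of two fields is the field $$a(z)_{(n)}b(z)=\operatorname{Res}_x\bigl(a(x)b(z)\,i_{x,z}(x-z)^n-b(z)a(x)\,i_{z,x}(x-z)^n\bigr),$$ where $i_{x,z}(x-z)^n=\sum_{j\ge0}\binom nj x^{n-j}(-z)^j$ and $i_{z,x}(x-z)^n=\sum_{j\ge0}\binom nj x^j(-z)^{n-j}$. Let $|0\rangle\in V$ be a nonzero vector (the vacuum). A state--field correspondence on $(V,|0\rangle)$ is a linear map $a\mapsto Y(a,z)=\sum_{n\in\mathbb Z}a_{(n)}z^{-n-1}$ from $V$ to the space of fields, such that $Y(|0\rangle,z)=I_V$, $Y(a,z)|0\rangle=a+T(a)z+\cdots\in V[[z]]$ for some $T\in\operatorname{End}V$, and $[T,Y(a,z)]=Y(Ta,z)=\partial_zY(a,z)$ for all $a\in V$. A strong field algebra is a state--field correspondence with $Y(a_{(n)}b,z)=Y(a,z)_{(n)}Y(b,z)$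 for all $a,b\in V$ and $n\in\mathbb Z$. A vertex algebra is a state--field correspondence such that for all $a,b\in V$ one has $(z-w)^N[Y(a,z),Y(b,w)]=0$ for $N\gg0$. **Theorem 6.1.** Let $(V,|0\rangle,Y)$ be a strong field algebra such that $|0\rangle=a_{(n)}c$ for some $a,c\in V$ and some integer $n\ge0$. Then $V$ is a vertex algebra. In particular, if a strong field algebra $(V,|0\rangle,Y)$ contains a Virasoro element with nonzero central charge, i.e., an element $\ell$ such that $$\ell_\lambda\ell=(T+2\lambda)\ell+\alpha\lambda^3|0\rangle\quad\text{with }\alpha\in\mathbb C\setminus\{0\},$$ where $a_\lambda b=\sum_{n\ge0}\lambda^n a_{(n)}b/n!$, then $V$ is a vertex algebra. -/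

import Mathlib

noncomputable section

open scoped Nat

namespace FieldAlg

variable {V : Type*} [AddCommGroup V] [Module ℂ V]

/-! An `End V`-valued field `a(z) = ∑ a_(n) z^(-n-1)` is a `VertexOperator ℂ V`, that is, a linear
map from `V` to Laurent series with coefficients in `V`.
Its mode `a_(n)` is `VertexOperator.ncoeff a n`. -/

open VertexOperator

theorem exists_ncoeff_eq_zero (a : VertexOperator ℂ V) (v : V) :
    ∃ N : ℕ, ∀ n : ℤ, (N : ℤ) ≤ n → ncoeff a n v = 0 := by
  refine ⟨(-(((HahnModule.of ℂ).symm (a v)).order)).toNat, fun n hn => ?_⟩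
  apply ncoeff_eq_zero_of_lt_order
  omega

/-- The `j`-th summand of the coefficient of `z^(-k-1)` in
`Res_x a(x) b(z) i_{x,z} (x-z)^n`, where `i_{x,z} (x-z)^n = ∑_j (n choose j) x^(n-j) (-z)^j`. -/
def nthProductLeft (a b : VertexOperator ℂ V) (n k : ℤ) (j : ℕ) : Module.End ℂ V :=
  ((-1 : ℂ) ^ j * (Ring.choose n j : ℤ)) • (ncoeff a (n - j) * ncoeff b (k + j))

/-- The `j`-th summand of the coefficient of `z^(-k-1)` in
`Res_x b(z) a(x) i_{z,x} (x-z)^n`, where `i_{z,x} (x-z)^n = ∑_j (n choose j) x^j (-z)^(n-j)`. -/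
def nthProductRight (a b : VertexOperator ℂ V) (n k : ℤ) (j : ℕ) : Module.End ℂ V :=
  ((-1 : ℂ) ^ (n - j) * (Ring.choose n j : ℤ)) • (ncoeff b (n + k - j) * ncoeff a j)

theorem nthProductLeft_finite (a b : VertexOperator ℂ V) (n k : ℤ) (v : V) :
    (Function.support fun j => nthProductLeft a b n k j v).Finite := by
  obtain ⟨N, hN⟩ := exists_ncoeff_eq_zero b v
  refine (Set.finite_lt_nat (N + k.natAbs)).subset fun j hj => ?_
  by_contra h
  simp only [Set.mem_ofPred_eq, not_lt] at h
  exact hj (by simp [nthProductLeft, hN (k + j) (by omega)])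

theorem nthProductRight_finite (a b : VertexOperator ℂ V) (n k : ℤ) (v : V) :
    (Function.support fun j => nthProductRight a b n k j v).Finite := by
  obtain ⟨N, hN⟩ := exists_ncoeff_eq_zero a v
  refine (Set.finite_lt_nat N).subset fun j hj => ?_
  by_contra h
  simp only [Set.mem_ofPred_eq, not_lt] at h
  exact hj (by simp [nthProductRight, hN j (by omega)])

/-- The `k`-th mode of the `n`-th product of two fields: the coefficient of `z^(-k-1)` in
`Res_x (a(x) b(z) i_{x,z} (x-z)^n - b(z) a(x) i_{z,x} (x-z)^n)`. On every vector both sums have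
only finitely many nonzero terms. -/
def nthProductMode (a b : VertexOperator ℂ V) (n k : ℤ) : Module.End ℂ V where
  toFun v := (∑ᶠ j : ℕ, nthProductLeft a b n k j v) - ∑ᶠ j : ℕ, nthProductRight a b n k j v
  map_add' u v := by
    simp only [map_add]
    rw [finsum_add_distrib (nthProductLeft_finite a b n k u) (nthProductLeft_finite a b n k v),
      finsum_add_distrib (nthProductRight_finite a b n k u) (nthProductRight_finite a b n k v)]
    abel
  map_smul' r v := by
    simp only [map_smul, RingHom.id_apply, smul_sub]
    rw [smul_finsum' _ (nthProductLeft_finite a b n k v),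
      smul_finsum' _ (nthProductRight_finite a b n k v)]

theorem exists_nthProductMode_eq_zero (a b : VertexOperator ℂ V) (n : ℤ) (v : V) :
    ∃ N : ℕ, ∀ k : ℤ, (N : ℤ) ≤ k → nthProductMode a b n k v = 0 := by
  obtain ⟨A, hA⟩ := exists_ncoeff_eq_zero a v
  obtain ⟨B, hB⟩ := exists_ncoeff_eq_zero b v
  choose C hC using fun j : ℕ => exists_ncoeff_eq_zero b (ncoeff a j v)
  refine ⟨B + n.natAbs + A + ∑ j ∈ Finset.range A, C j, fun k hk => ?_⟩
  have h1 : ∀ j : ℕ, nthProductLeft a b n k j v = 0 := fun j => by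
    simp [nthProductLeft, hB (k + j) (by omega)]
  have h2 : ∀ j : ℕ, nthProductRight a b n k j v = 0 := fun j => by
    by_cases hj : j < A
    · have := Finset.single_le_sum (f := C) (fun i _ => Nat.zero_le _) (Finset.mem_range.2 hj)
      simp [nthProductRight, hC j (n + k - j) (by omega)]
    · simp [nthProductRight, hA j (by omega)]
  simp [nthProductMode, h1, h2]

/-- The `n`-th product `a(z)_(n) b(z)` of two fields, `n ∈ ℤ`, which is again a field. -/
def nthProduct (a b : VertexOperator ℂ V) (n : ℤ) : VertexOperator ℂ V :=
  VertexOperator.of_coeff (fun m => nthProductMode a b n (-m - 1)) fun v => by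
    obtain ⟨N, hN⟩ := exists_nthProductMode_eq_zero a b n v
    refine ⟨-N - 1, fun m hm => ?_⟩
    by_contra h
    exact hm (hN _ (by omega))

theorem ncoeff_nthProduct (a b : VertexOperator ℂ V) (n k : ℤ) :
    ncoeff (nthProduct a b n) k = nthProductMode a b n k := by
  simp [nthProduct]

/-- Multiplication by `z - w` of an `End V`-valued formal distribution
`∑ D p q z^(-p-1) w^(-q-1)`. -/
def mulZSubW (D : ℤ → ℤ → Module.End ℂ V) : ℤ → ℤ → Module.End ℂ V :=
  fun p q => D (p + 1) q - D p (q + 1)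

/-- The formal distribution `[a(z), b(w)]`. -/
def fieldCommutator (a b : VertexOperator ℂ V) : ℤ → ℤ → Module.End ℂ V :=
  fun p q => ncoeff a p * ncoeff b q - ncoeff b q * ncoeff a p

/-- A pair of fields is local if `(z - w)^N [a(z), b(w)] = 0` for `N ≫ 0`. -/
def IsLocalPair (a b : VertexOperator ℂ V) : Prop :=
  ∃ N₀ : ℕ, ∀ N : ℕ, N₀ ≤ N → mulZSubW^[N] (fieldCommutator a b) = 0

/-- A complex vector space `V` with a nonzero vacuum vector and a state--field correspondence
`Y(a,z) = ∑ a_(n) z^(-n-1)` with translation operator `T`; the axioms are written in modes. -/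
structure StateFieldCorrespondence (V : Type*) [AddCommGroup V] [Module ℂ V] where
  /-- the vacuum vector -/
  vac : V
  vac_ne_zero : vac ≠ 0
  /-- the map `a ↦ Y(a,z)` -/
  Y : V →ₗ[ℂ] VertexOperator ℂ V
  /-- the translation operator -/
  T : Module.End ℂ V
  /-- `Y(vac, z)` is the identity operator. -/
  vac_mode : ∀ n : ℤ, ncoeff (Y vac) n = if n = -1 then 1 else 0
  /-- `Y(a,z) vac` is a formal power series `a + T(a) z + ⋯`. -/
  mode_vac_of_nonneg : ∀ (a : V) (n : ℤ), 0 ≤ n → ncoeff (Y a) n vac = 0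
  mode_neg_one_vac : ∀ a : V, ncoeff (Y a) (-1) vac = a
  mode_neg_two_vac : ∀ a : V, ncoeff (Y a) (-2) vac = T a
  /-- `[T, Y(a,z)] = Y(Ta,z)` -/
  translation_comm : ∀ (a : V) (n : ℤ),
    T * ncoeff (Y a) n - ncoeff (Y a) n * T = ncoeff (Y (T a)) n
  /-- `Y(Ta,z) = ∂_z Y(a,z)` -/
  translation_deriv : ∀ (a : V) (n : ℤ),
    ncoeff (Y (T a)) n = (-n : ℂ) • ncoeff (Y a) (n - 1)

namespace StateFieldCorrespondence

variable (S : StateFieldCorrespondence V)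

/-- The element `a_(n) b`. -/
def mode (a : V) (n : ℤ) (b : V) : V := ncoeff (S.Y a) n b

/-- A strong field algebra: `Y(a_(n) b, z) = Y(a,z)_(n) Y(b,z)` for all `a, b` and all `n ∈ ℤ`. -/
def IsStrongFieldAlgebra : Prop :=
  ∀ (a b : V) (n : ℤ), S.Y (S.mode a n b) = nthProduct (S.Y a) (S.Y b) n

/-- A vertex algebra: all pairs of fields `Y(a,z)`, `Y(b,z)` are local. -/
def IsVertexAlgebra : Prop :=
  ∀ a b : V, IsLocalPair (S.Y a) (S.Y b)

/-- The `λ`-product `a_λ b = ∑_{n ≥ 0} λ^n a_(n) b / n!`, a polynomial in `λ` with coefficients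
in `V`. -/
def lambdaProduct (a b : V) : PolynomialModule ℂ V :=
  PolynomialModule.ofCoeff ℂ <| Finsupp.ofSupportFinite
    (fun n : ℕ => ((n ! : ℂ)⁻¹) • S.mode a n b) <| by
    obtain ⟨N, hN⟩ := exists_ncoeff_eq_zero (S.Y a) b
    refine (Set.finite_lt_nat N).subset fun j hj => ?_
    by_contra h
    simp only [Set.mem_ofPred_eq, not_lt] at h
    exact hj (by simp [mode, hN j (by omega)])

/-- `ℓ_λ ℓ = (T + 2 λ) ℓ + α λ^3 vac`; the central charge is `12 α`. -/
def IsVirasoroElement (l : V) (α : ℂ) : Prop :=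
  S.lambdaProduct l l =
    PolynomialModule.single ℂ 0 (S.T l) + PolynomialModule.single ℂ 1 ((2 : ℂ) • l) +
      PolynomialModule.single ℂ 3 (α • S.vac)

end StateFieldCorrespondence

end FieldAlg

end

/-! For `n ≥ 0` the two expansions of `(x-z)^n` coincide, so the product identity says that `b_(n)
c` has field `Res_x (x-z)^n [b(x), c(z)]`. This gives the commutator formula `[b_(m), c_(q)] = ∑_j
(m choose j) (b_(j) c)_(m+q-j)` for `m ≥ 0`. If the formula holds for every `m ∈ ℤ`, the commutator
is a finite sum of derivatives of the delta function, and locality follows. So the task is to kill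
the defect `D` of the formula at negative `m`.

Apply the formula to `u_(k)` and `c_(q)`, where `u = a_(r-k) b` and `k` is large, and expand `u` by
the product identity. Everything collapses to `∑_i (-1)^i (r-k choose i) D(b, r-i, c, q) a_(i) v =
0` (`exists_sum_commutatorDefect`). The number of terms does not depend on `k`, and binomials of
different degree in `k` are linearly independent, so `D` kills each `a_(i) v` with `i ≥ 0`
(`commutatorDefect_op`). Expanding `(a_(m+t-k) f)_(k) v` and separating in the same way, `D` also
kills `f_(m) a_(t) v` for `t ≥ 0` and every integer `m` (`commutatorDefect_op_op`). If the vacuum is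
`a_(n) c` with `n ≥ 0`, then `v = (a_(n) c)_(-1) v` is a sum of vectors of these two kinds, so `D =
0`. -/

noncomputable section

open scoped Nat

namespace FieldAlg

/-! ### Binomial identities -/

/-- The generalized binomial coefficient `n choose j` as a complex number. -/
def binom (n : ℤ) (j : ℕ) : ℂ := (Ring.choose n j : ℤ)

@[simp] theorem binom_zero_right (n : ℤ) : binom n 0 = 1 := by simp [binom]

theorem binom_zero_succ (j : ℕ) : binom 0 (j + 1) = 0 := by simp [binom]

theorem binom_succ_succ (n : ℤ) (j : ℕ) :
    binom (n + 1) (j + 1) = binom n j + binom n (j + 1) := by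
  simp [binom, Ring.choose_succ_succ]

theorem binom_natCast (n j : ℕ) : binom n j = n.choose j := by
  simp [binom, Ring.choose_natCast]

theorem binom_natCast_symm {n j : ℕ} (h : j ≤ n) : binom n (n - j) = binom n j := by
  rw [binom_natCast, binom_natCast, Nat.choose_symm h]

theorem binom_natCast_eq_zero {n j : ℕ} (h : n < j) : binom n j = 0 := by
  rw [binom_natCast, Nat.choose_eq_zero_of_lt h, Nat.cast_zero]

theorem binom_mul_binom_add (n : ℤ) (i j : ℕ) :
    binom n i * binom (n - i) j = binom n (i + j) * binom (i + j : ℕ) i := by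
  have h := Ring.choose_smul_choose n (Nat.le_add_right i j)
  rw [Nat.add_sub_cancel_left, nsmul_eq_mul] at h
  rw [binom_natCast, mul_comm (binom n (i + j))]
  simp only [binom]
  exact_mod_cast h.symm

theorem binom_mul_binom_comm (n : ℤ) (i j : ℕ) :
    binom n i * binom (n - i) j = binom n j * binom (n - j) i := by
  rw [binom_mul_binom_add, binom_mul_binom_add, add_comm j i, binom_natCast, binom_natCast,
    Nat.choose_symm_add]

theorem sum_binom_mul_binom (m n : ℤ) (h : ℕ) :
    ∑ i ∈ Finset.range (h + 1), binom m i * binom n (h - i) = binom (m + n) h := by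
  rw [← Finset.Nat.sum_antidiagonal_eq_sum_range_succ (fun i j => binom m i * binom n j)]
  simp only [binom]
  rw [Ring.add_choose_eq h (Commute.all m n)]
  push_cast
  rfl

/-- Vandermonde in disguise: negating the upper index turns the signed factor into `(m-n-k-1 choose
x.2)`, whose upper index no longer depends on the summation variable. The induction uses only
Pascal's rule. -/
theorem sum_antidiagonal_neg_one_pow_binom (k : ℕ) (n : ℤ) (m : ℕ) :
    ∑ x ∈ Finset.HasAntidiagonal.antidiagonal m, binom k x.1 * (-1) ^ x.2 * binom (n + k - x.1) x.2 =
      (-1) ^ m * binom n m := by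
  induction k generalizing n m with
  | zero =>
    rw [Finset.sum_eq_single (0, m)]
    · simp
    · rintro ⟨i, j⟩ hij hne
      rcases i with _ | i
      · simp_all
      · simp [binom_zero_succ]
    · simp
  | succ k ih =>
    cases m with
    | zero => simp
    | succ m =>
      have h1 := ih (n + 1) (m + 1)
      have h2 := ih n m
      rw [Finset.Nat.sum_antidiagonal_succ] at h1 ⊢
      have e : ∀ x ∈ Finset.HasAntidiagonal.antidiagonal m, binom (k + 1 : ℕ) (x.1 + 1) * (-1) ^ x.2 *
          binom (n + (k + 1 : ℕ) - (x.1 + 1 : ℕ)) x.2 =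
          binom k (x.1 + 1) * (-1) ^ x.2 * binom (n + 1 + k - (x.1 + 1 : ℕ)) x.2 +
          binom k x.1 * (-1) ^ x.2 * binom (n + k - x.1) x.2 := by
        intro x _
        rw [show ((k + 1 : ℕ) : ℤ) = (k : ℤ) + 1 by push_cast; ring, binom_succ_succ,
          show n + ((k : ℤ) + 1) - (x.1 + 1 : ℕ) = n + k - x.1 by push_cast; ring,
          show n + 1 + (k : ℤ) - (x.1 + 1 : ℕ) = n + k - x.1 by push_cast; ring]
        ring
      rw [Finset.sum_congr rfl e, Finset.sum_add_distrib, h2]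
      rw [binom_succ_succ] at h1
      rw [show n + ((k + 1 : ℕ) : ℤ) - (0 : ℕ) = n + 1 + k - (0 : ℕ) by push_cast; ring]
      simp only [binom_zero_right] at h1 ⊢
      linear_combination h1

/-- A `k`-th finite difference kills a polynomial of degree `s < k`. -/
theorem sum_neg_one_pow_binom_eq_zero (k : ℕ) (n : ℤ) (s : ℕ) (hs : s < k) :
    ∑ j ∈ Finset.range (k + 1), (-1) ^ j * binom k j * binom (n + j) s = 0 := by
  induction k generalizing n s with
  | zero => omega
  | succ k ih =>
    have e : ∀ j : ℕ, (-1 : ℂ) ^ (j + 1) * binom (k + 1 : ℕ) (j + 1) *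
        binom (n + (j + 1 : ℕ)) s =
        (-1) ^ (j + 1) * binom k (j + 1) * binom (n + (j + 1 : ℕ)) s
          - (-1) ^ j * binom k j * binom (n + 1 + j) s := by
      intro j
      rw [show ((k + 1 : ℕ) : ℤ) = (k : ℤ) + 1 by push_cast; ring, binom_succ_succ,
        show n + (j + 1 : ℕ) = n + 1 + j by push_cast; ring]
      ring
    have h0 : ∑ j ∈ Finset.range (k + 1), (-1 : ℂ) ^ j * binom k j * binom (n + 1 + j) s =
        ∑ j ∈ Finset.range (k + 1), (-1 : ℂ) ^ j * binom k j * binom (n + j) s := by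
      rw [← sub_eq_zero, ← Finset.sum_sub_distrib]
      rcases s with _ | s
      · simp
      · rw [← ih n s (by omega)]
        refine Finset.sum_congr rfl fun j _ => ?_
        rw [show n + 1 + (j : ℤ) = n + j + 1 by ring, binom_succ_succ]
        ring
    rw [Finset.sum_range_succ', Finset.sum_congr rfl fun j _ => e j, Finset.sum_sub_distrib, h0]
    have h1 : ∑ j ∈ Finset.range (k + 2), (-1 : ℂ) ^ j * binom k j * binom (n + j) s =
        ∑ j ∈ Finset.range (k + 1), (-1 : ℂ) ^ j * binom k j * binom (n + j) s := by
      rw [Finset.sum_range_succ, binom_natCast_eq_zero (Nat.lt_succ_self k)]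
      simp
    rw [Finset.sum_range_succ'] at h1
    simp only [binom_zero_right] at h1 ⊢
    linear_combination h1

/-! ### Double sums and linear independence of binomials -/

/-- A double sum whose terms vanish for `i + j ≥ M`, regrouped along antidiagonals. -/
theorem sum_range_sum_range_eq {W : Type*} [AddCommMonoid W] (f : ℕ → ℕ → W) {M A B : ℕ}
    (hA : M ≤ A) (hB : M ≤ B) (hf : ∀ i j, M ≤ i + j → f i j = 0) :
    ∑ i ∈ Finset.range A, ∑ j ∈ Finset.range B, f i j =
      ∑ h ∈ Finset.range M, ∑ i ∈ Finset.range (h + 1), f i (h - i) := by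
  rw [Finset.sum_range_diag_flip]
  rw [← Finset.sum_subset (Finset.range_mono hA)]
  · refine Finset.sum_congr rfl fun i _ => ?_
    rw [← Finset.sum_subset (Finset.range_mono (show M - i ≤ B by omega))]
    intro j _ hj
    rw [Finset.mem_range] at hj
    exact hf _ _ (by omega)
  · intro i _ hi
    rw [Finset.mem_range] at hi
    exact Finset.sum_eq_zero fun j _ => hf _ _ (by omega)

/-- The functions `m ↦ (m choose t)` are linearly independent on every half-line `m ≤ M`. -/
theorem eq_zero_of_sum_binom_smul_eq_zero {W : Type*} [AddCommGroup W] [Module ℂ W] (n : ℕ)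
    (w : ℕ → W) (M : ℤ) (h : ∀ m ≤ M, ∑ t ∈ Finset.range n, binom m t • w t = 0) :
    ∀ t < n, w t = 0 := by
  induction n generalizing w M with
  | zero => intro t ht; omega
  | succ n ih =>
    have h1 : ∀ t < n, w (t + 1) = 0 := by
      -- Subtracting the relations at `m + 1` and `m` lowers every degree by one; both must lie
      -- below `M`, hence the bound `M - 1`.
      refine ih (fun t => w (t + 1)) (M - 1) fun m hm => ?_
      have e := (h (m + 1) (by omega)).trans (h m (by omega)).symm
      rw [Finset.sum_range_succ', Finset.sum_range_succ'] at e
      simp only [binom_succ_succ, add_smul, Finset.sum_add_distrib, binom_zero_right] at e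
      simpa [add_assoc] using e
    have h0 : w 0 = 0 := by
      have e := h M le_rfl
      rw [Finset.sum_range_succ', Finset.sum_eq_zero] at e
      · simpa using e
      · intro t ht
        rw [h1 t (Finset.mem_range.1 ht), smul_zero]
    intro t ht
    cases t with
    | zero => exact h0
    | succ t => exact h1 t (by omega)

theorem eq_zero_of_eventually_sum_binom_smul {W : Type*} [AddCommGroup W] [Module ℂ W] (n : ℕ)
    (w : ℕ → W) (r : ℤ) (K : ℕ)
    (h : ∀ k : ℕ, K ≤ k → ∑ t ∈ Finset.range n, ((-1) ^ t * binom (r - k) t) • w t = 0) :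
    ∀ t < n, w t = 0 := by
  intro t ht
  have := eq_zero_of_sum_binom_smul_eq_zero n (fun t => (-1 : ℂ) ^ t • w t) (r - K)
    (fun m hm => by
      rw [← h (r - m).toNat (by omega), show r - ((r - m).toNat : ℤ) = m by omega]
      refine Finset.sum_congr rfl fun t _ => ?_
      rw [smul_smul, mul_comm]) t ht
  exact (smul_eq_zero.1 this).resolve_left (pow_ne_zero _ (by norm_num))

/-! ### Multiplication of formal distributions by `z - w` -/

open VertexOperator Finset

variable {V : Type*} [AddCommGroup V] [Module ℂ V]

theorem mulZSubW_iterate_add (n : ℕ) (D E : ℤ → ℤ → Module.End ℂ V) :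
    mulZSubW^[n] (D + E) = mulZSubW^[n] D + mulZSubW^[n] E := by
  induction n generalizing D E with
  | zero => rfl
  | succ n ih =>
    rw [Function.iterate_succ_apply, Function.iterate_succ_apply, Function.iterate_succ_apply,
      ← ih]
    congr 1
    ext p q v
    simp only [mulZSubW, Pi.add_apply, LinearMap.sub_apply, LinearMap.add_apply]
    abel

theorem mulZSubW_iterate_zero (n : ℕ) :
    mulZSubW^[n] (0 : ℤ → ℤ → Module.End ℂ V) = 0 := by
  induction n with
  | zero => rfl
  | succ n ih =>
    rw [Function.iterate_succ_apply]
    convert ih using 2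
    ext p q v
    simp [mulZSubW]

theorem mulZSubW_iterate_sum (n M : ℕ) (D : ℕ → ℤ → ℤ → Module.End ℂ V) :
    mulZSubW^[n] (∑ j ∈ range M, D j) = ∑ j ∈ range M, mulZSubW^[n] (D j) := by
  induction M with
  | zero => simpa using mulZSubW_iterate_zero n
  | succ M ih => rw [sum_range_succ, sum_range_succ, mulZSubW_iterate_add, ih]

theorem mulZSubW_iterate_apply (n : ℕ) (D : ℤ → ℤ → Module.End ℂ V) (p q : ℤ) :
    mulZSubW^[n] D p q =
      ∑ j ∈ range (n + 1), ((-1) ^ j * binom n j) • D (p + n - j) (q + j) := by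
  induction n generalizing D p q with
  | zero => simp
  | succ n ih =>
    rw [Function.iterate_succ_apply, ih]
    simp only [mulZSubW, smul_sub, sum_sub_distrib]
    rw [sum_range_succ', sum_range_succ' _ (n + 1)]
    have e : ∀ j : ℕ, ((-1 : ℂ) ^ (j + 1) * binom (n + 1 : ℕ) (j + 1)) •
        D (p + (n + 1 : ℕ) - (j + 1 : ℕ)) (q + (j + 1 : ℕ)) =
        ((-1 : ℂ) ^ (j + 1) * binom n (j + 1)) •
          D (p + n - (j + 1 : ℕ) + 1) (q + (j + 1 : ℕ)) -
        ((-1 : ℂ) ^ j * binom n j) • D (p + n - j) (q + j + 1) := by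
      intro j
      rw [show ((n + 1 : ℕ) : ℤ) = (n : ℤ) + 1 by push_cast; ring, binom_succ_succ,
        show p + ((n : ℤ) + 1) - (j + 1 : ℕ) = p + n - j by push_cast; ring,
        show p + n - ((j + 1 : ℕ) : ℤ) + 1 = p + n - j by push_cast; ring,
        show q + ((j + 1 : ℕ) : ℤ) = q + j + 1 by push_cast; ring, ← sub_smul]
      congr 1
      ring
    rw [sum_congr rfl fun j _ => e j, sum_sub_distrib,
      sum_range_succ (fun j : ℕ => ((-1 : ℂ) ^ (j + 1) * binom n (j + 1)) •
          D (p + n - (j + 1 : ℕ) + 1) (q + (j + 1 : ℕ))),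
      binom_natCast_eq_zero (Nat.lt_succ_self n)]
    simp only [mul_zero, zero_smul, add_zero, binom_zero_right, pow_zero, mul_one, one_smul,
      Nat.cast_zero, sub_zero]
    rw [show p + (n : ℤ) + 1 = p + (n + 1 : ℕ) by push_cast; ring]
    abel

/-- Reconstruction of a formal distribution in the range `0 ≤ m` from the coefficients of its
products with powers of `z - w`. -/
theorem eq_sum_mulZSubW_iterate (D : ℤ → ℤ → Module.End ℂ V) (m : ℕ) (q : ℤ) :
    D m q = ∑ j ∈ range (m + 1), binom m j • mulZSubW^[j] D 0 (m + q - j) := by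
  induction m generalizing D q with
  | zero => simp
  | succ m ih =>
    have h1 := ih (mulZSubW D) q
    have h2 := ih D (q + 1)
    -- This is `z = (z - w) + w`; iterated, it expands `z^m` binomially.
    have h3 : D (m + 1 : ℕ) q = mulZSubW D m q + D m (q + 1) := by simp [mulZSubW]
    rw [h3, h1, h2, sum_range_succ' _ (m + 1)]
    have e : ∀ j : ℕ, binom (m + 1 : ℕ) (j + 1) •
        mulZSubW^[j + 1] D 0 ((m + 1 : ℕ) + q - (j + 1 : ℕ)) =
        binom m j • mulZSubW^[j] (mulZSubW D) 0 (m + q - j) +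
        binom m (j + 1) • mulZSubW^[j + 1] D 0 (m + (q + 1) - (j + 1 : ℕ)) := by
      intro j
      rw [show ((m + 1 : ℕ) : ℤ) = (m : ℤ) + 1 by push_cast; ring, binom_succ_succ, add_smul,
        Function.iterate_succ_apply,
        show (m : ℤ) + 1 + q - (j + 1 : ℕ) = m + q - j by push_cast; ring,
        show (m : ℤ) + (q + 1) - (j + 1 : ℕ) = m + q - j by push_cast; ring]
    rw [sum_congr rfl fun j _ => e j, sum_add_distrib,
      sum_range_succ (fun j : ℕ => binom m (j + 1) • mulZSubW^[j + 1] D 0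
        (m + (q + 1) - (j + 1 : ℕ))), binom_natCast_eq_zero (Nat.lt_succ_self m), zero_smul,
      add_zero, add_assoc,
      sum_range_succ' (fun j : ℕ => binom m j • mulZSubW^[j] D 0 (m + (q + 1) - j)) m]
    congr 2
    rw [show (((m + 1 : ℕ) : ℤ) + q - (0 : ℕ)) = m + (q + 1) - (0 : ℕ) by push_cast; ring]
    simp

/-- `(z - w)^(j+1)` annihilates `∂_w^j δ(z, w)` times a field in `w`. -/
theorem mulZSubW_iterate_binom_smul (j n : ℕ) (hn : j < n) (E : ℤ → Module.End ℂ V) :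
    mulZSubW^[n] (fun p q => binom p j • E (p + q)) = 0 := by
  induction j generalizing n E with
  | zero =>
    obtain ⟨n, rfl⟩ := Nat.exists_eq_succ_of_ne_zero (by omega : n ≠ 0)
    rw [Function.iterate_succ_apply]
    convert mulZSubW_iterate_zero n using 2
    ext p q v
    simp [mulZSubW, show p + 1 + q = p + (q + 1) by ring]
  | succ j ih =>
    obtain ⟨n, rfl⟩ := Nat.exists_eq_succ_of_ne_zero (by omega : n ≠ 0)
    rw [Function.iterate_succ_apply]
    convert ih n (by omega) (fun r => E (r + 1)) using 2
    ext p q v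
    simp only [mulZSubW, binom_succ_succ, show p + 1 + q = p + q + 1 by ring,
      show p + (q + 1) = p + q + 1 by ring, add_smul, add_sub_cancel_right]

/-! ### The commutator formula for nonnegative modes -/

namespace StateFieldCorrespondence

variable (S : StateFieldCorrespondence V)

/-- The mode `a_(n)` of the field `Y(a,z)`. -/
abbrev op (a : V) (n : ℤ) : Module.End ℂ V := ncoeff (S.Y a) n

@[simp] theorem op_zero (n : ℤ) : S.op 0 n = 0 := by simp [op]

theorem op_neg_one_vac (v : V) : S.op S.vac (-1) v = v := by simp [op, S.vac_mode]

variable {S}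

/-- The product identity with both sums truncated. The bounds are free, so a sum whose terms all
vanish is dropped by taking its bound to be `0`. -/
theorem IsStrongFieldAlgebra.op_op (hS : S.IsStrongFieldAlgebra) (a b : V) (n k : ℤ) (v : V)
    {M₁ M₂ : ℕ} (h₁ : ∀ j : ℕ, M₁ ≤ j → S.op b (k + j) v = 0)
    (h₂ : ∀ j : ℕ, M₂ ≤ j → S.op a j v = 0) :
    S.op (S.op a n b) k v =
      ∑ j ∈ range M₁, ((-1) ^ j * binom n j) • S.op a (n - j) (S.op b (k + j) v) -
      ∑ j ∈ range M₂, ((-1) ^ n * (-1) ^ j * binom n j) •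
        S.op b (n + k - j) (S.op a j v) := by
  have h : S.op (S.op a n b) k = nthProductMode (S.Y a) (S.Y b) n k := by
    rw [← ncoeff_nthProduct, ← hS]; rfl
  rw [h]
  change (∑ᶠ j : ℕ, nthProductLeft (S.Y a) (S.Y b) n k j v) -
    ∑ᶠ j : ℕ, nthProductRight (S.Y a) (S.Y b) n k j v = _
  rw [finsum_eq_sum_of_support_subset (s := range M₁),
    finsum_eq_sum_of_support_subset (s := range M₂)]
  · congr 1
    refine sum_congr rfl fun j _ => ?_
    have : (-1 : ℂ) ^ (n - (j : ℤ)) = (-1) ^ n * (-1) ^ j := by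
      rw [zpow_sub₀ (by norm_num), zpow_natCast, div_eq_mul_inv, ← inv_pow]
      norm_num
    simp [nthProductRight, binom, this]
  · intro j hj
    by_contra hj'
    simp only [coe_range, Set.mem_Iio, not_lt] at hj'
    exact hj (by simp [nthProductRight, show ncoeff (S.Y a) j v = 0 from h₂ j hj'])
  · intro j hj
    by_contra hj'
    simp only [coe_range, Set.mem_Iio, not_lt] at hj'
    exact hj (by simp [nthProductLeft, show ncoeff (S.Y b) (k + j) v = 0 from h₁ j hj'])

variable (S) in
/-- The right-hand side `∑_j (m choose j) (b_(j) c)_(m+q-j)` of the commutator formula for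
`[b_(m), c_(q)]`. -/
def commutatorSum (b : V) (m : ℤ) (c : V) (q : ℤ) : Module.End ℂ V :=
  ∑ᶠ j : ℕ, binom m j • S.op (S.op b j c) (m + q - j)

variable (S) in
/-- The defect of the commutator formula for `[b_(m), c_(q)]`. -/
def commutatorDefect (b : V) (m : ℤ) (c : V) (q : ℤ) : Module.End ℂ V :=
  S.op b m * S.op c q - S.op c q * S.op b m - S.commutatorSum b m c q

theorem commutatorSum_eq {b c : V} {M : ℕ} (h : ∀ j : ℕ, M ≤ j → S.op b j c = 0) (m q : ℤ) :
    S.commutatorSum b m c q = ∑ j ∈ range M, binom m j • S.op (S.op b j c) (m + q - j) := by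
  refine finsum_eq_sum_of_support_subset _ fun j hj => ?_
  by_contra hj'
  simp only [coe_range, Set.mem_Iio, not_lt] at hj'
  exact hj (by simp only [h j hj', op_zero, smul_zero])

theorem commutatorSum_natCast (b : V) (m : ℕ) (c : V) (q : ℤ) :
    S.commutatorSum b m c q =
      ∑ j ∈ range (m + 1), binom m j • S.op (S.op b j c) (m + q - j) := by
  refine finsum_eq_sum_of_support_subset _ fun j hj => ?_
  by_contra hj'
  simp only [coe_range, Set.mem_Iio, not_lt] at hj'
  exact hj (by simp only [binom_natCast_eq_zero (show m < j by omega), zero_smul])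

/-- For `n ≥ 0` the factor `(z-w)^n` is a polynomial, so both expansions agree and the two products
merge into a commutator. -/
theorem IsStrongFieldAlgebra.op_op_natCast (hS : S.IsStrongFieldAlgebra) (b c : V) (n : ℕ)
    (k : ℤ) : S.op (S.op b n c) k = mulZSubW^[n] (fieldCommutator (S.Y b) (S.Y c)) 0 k := by
  ext v
  obtain ⟨B, hB⟩ := exists_ncoeff_eq_zero (S.Y b) v
  obtain ⟨C, hC⟩ := exists_ncoeff_eq_zero (S.Y c) v
  have h1 : ∀ j : ℕ, n < j → binom n j = 0 := fun j hj => binom_natCast_eq_zero hj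
  rw [hS.op_op b c n k v (M₁ := n + 1 + C + k.natAbs) (M₂ := n + 1 + B)
    (fun j hj => hC _ (by omega)) (fun j hj => hB _ (by omega)), mulZSubW_iterate_apply,
    ← sum_subset (range_mono (show n + 1 ≤ n + 1 + C + k.natAbs by omega)),
    ← sum_subset (range_mono (show n + 1 ≤ n + 1 + B by omega)),
    -- The two expansions list the powers of the variables in opposite order, so `j ↦ n - j` aligns
    -- the second sum with the first.
    ← sum_range_reflect (fun j : ℕ => ((-1 : ℂ) ^ (n : ℤ) * (-1) ^ j * binom n j) •
        S.op c (n + k - j) (S.op b j v)), ← sum_sub_distrib, LinearMap.sum_apply]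
  · refine sum_congr rfl fun j hj => ?_
    rw [mem_range] at hj
    have hsub : n + 1 - 1 - j = n - j := by omega
    have hc : ((n - j : ℕ) : ℤ) = n - j := by omega
    have hsign : (-1 : ℂ) ^ (n : ℤ) * (-1) ^ (n - j) = (-1) ^ j := by
      rw [zpow_natCast]
      obtain ⟨i, rfl⟩ := Nat.exists_eq_add_of_le (show j ≤ n by omega)
      rw [Nat.add_sub_cancel_left, pow_add, mul_assoc, ← mul_pow]
      norm_num
    rw [hsub, hsign, binom_natCast_symm (by omega), hc,
      show (n : ℤ) + k - (n - j) = k + j by ring, zero_add]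
    simp [fieldCommutator, op, smul_sub]
  all_goals
    intro j _ hj
    rw [mem_range] at hj
    rw [h1 j (by omega), mul_zero, zero_smul]

theorem IsStrongFieldAlgebra.commutatorDefect_natCast (hS : S.IsStrongFieldAlgebra) (b : V)
    (m : ℕ) (c : V) (q : ℤ) : S.commutatorDefect b m c q = 0 := by
  have h := eq_sum_mulZSubW_iterate (fieldCommutator (S.Y b) (S.Y c)) m q
  rw [commutatorDefect, commutatorSum_natCast, sub_eq_zero]
  simp only [hS.op_op_natCast]
  exact h

/-- With no defect the commutator is a finite sum of `∂_w^j δ(z, w)` terms with `j < M`, all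
annihilated by `(z - w)^M`. -/
theorem isVertexAlgebra_of_commutatorDefect_eq_zero
    (h : ∀ b m c q, S.commutatorDefect b m c q = 0) : S.IsVertexAlgebra := by
  intro b c
  obtain ⟨M, hM⟩ := exists_ncoeff_eq_zero (S.Y b) c
  refine ⟨M, fun N hN => ?_⟩
  have e : fieldCommutator (S.Y b) (S.Y c) =
      ∑ j ∈ range M, fun p q => binom p j • S.op (S.op b j c) (p + q - j) := by
    ext p q : 2
    rw [Finset.sum_apply, Finset.sum_apply,
      ← commutatorSum_eq (fun j hj => hM j (by omega)), ← sub_eq_zero]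
    exact h b p c q
  rw [e, mulZSubW_iterate_sum]
  refine sum_eq_zero fun j hj => ?_
  rw [mem_range] at hj
  exact mulZSubW_iterate_binom_smul j N (by omega) fun r => S.op (S.op b j c) (r - j)

end StateFieldCorrespondence

/-! ### Regrouping the triple sums of the main identity -/

/-- Exchanging `i` and `s` in `(p choose i)(p-i choose s)` leaves a Vandermonde sum over `i + j =
h`. Since `M ≤ k + 1`, stopping at `j = k` loses nothing. -/
theorem sum_binom_smul_regroup_diag {W : Type*} [AddCommGroup W] [Module ℂ W] {k M : ℕ}
    (p : ℤ) (G : ℕ → ℕ → W) (hk : M ≤ k + 1) (hG : ∀ h s, M ≤ h → G h s = 0) :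
    ∑ j ∈ range (k + 1), ∑ i ∈ range M, ∑ s ∈ range M,
      (binom k j * binom p i * ((-1) ^ s * binom (p - i) s)) • G (i + j) s =
    ∑ s ∈ range M, ((-1) ^ s * binom p s) •
      ∑ h ∈ range M, binom (p + k - s) h • G h s := by
  have e : ∀ s : ℕ, ∑ i ∈ range M, ∑ j ∈ range (k + 1),
      (binom k j * binom p i * ((-1) ^ s * binom (p - i) s)) • G (i + j) s =
      ((-1) ^ s * binom p s) • ∑ h ∈ range M, binom (p + k - s) h • G h s := by
    intro s
    rw [sum_range_sum_range_eq _ le_rfl hk (fun i j hij => by rw [hG _ _ hij, smul_zero]),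
      smul_sum]
    refine sum_congr rfl fun h _ => ?_
    rw [show p + (k : ℤ) - s = p - s + k by ring, ← sum_binom_mul_binom, sum_smul, smul_sum]
    refine sum_congr rfl fun i hi => ?_
    rw [mem_range] at hi
    rw [show i + (h - i) = h by omega, smul_smul]
    congr 1
    linear_combination (binom k (h - i) * (-1) ^ s) * binom_mul_binom_comm p i s
  rw [sum_comm, sum_congr rfl fun i _ => sum_comm, sum_comm]
  exact sum_congr rfl fun s _ => e s

/-- After `j = k - l`, the sum over `l + s = m` is the signed Vandermonde identity. The surviving
`(p choose i)(p-i choose m)` is then rewritten in terms of `i + m`. -/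
theorem sum_binom_smul_regroup_reflect {W : Type*} [AddCommGroup W] [Module ℂ W] {k M : ℕ}
    (p : ℤ) (G : ℕ → ℕ → W) (hk : M ≤ k + 1) (hG : ∀ h m, M ≤ h + m → G h m = 0) :
    ∑ j ∈ range (k + 1), ∑ i ∈ range M, ∑ s ∈ range M,
      (binom k j * ((-1) ^ i * binom p i) * ((-1) ^ s * binom (p + j - i) s)) •
        G i (s + (k - j)) =
    ∑ i ∈ range M, ((-1) ^ i * binom p i) •
      ∑ h ∈ range (i + 1), binom i h • G h (i - h) := by
  have e : ∀ i : ℕ, ∑ j ∈ range (k + 1), ∑ s ∈ range M,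
      (binom k j * ((-1) ^ i * binom p i) * ((-1) ^ s * binom (p + j - i) s)) •
        G i (s + (k - j)) =
      ∑ m ∈ range M, (((-1) ^ i * binom p i) * ((-1) ^ m * binom (p - i) m)) • G i m := by
    intro i
    rw [← sum_range_reflect]
    have e' : ∀ l ∈ range (k + 1), ∑ s ∈ range M,
        (binom k (k + 1 - 1 - l : ℕ) * ((-1) ^ i * binom p i) *
          ((-1) ^ s * binom (p + (k + 1 - 1 - l : ℕ) - i) s)) •
            G i (s + (k - (k + 1 - 1 - l))) =
        ∑ s ∈ range M, (binom k l * ((-1) ^ i * binom p i) *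
          ((-1) ^ s * binom (p - i + k - l) s)) • G i (l + s) := by
      intro l hl
      rw [mem_range] at hl
      refine sum_congr rfl fun s _ => ?_
      rw [show k + 1 - 1 - l = k - l by omega, binom_natCast_symm (by omega),
        show s + (k - (k - l)) = l + s by omega,
        show p + ((k - l : ℕ) : ℤ) - i = p - i + k - l by omega]
    rw [sum_congr rfl e', sum_range_sum_range_eq _ hk le_rfl (fun l s hls => by
      rw [hG _ _ (by omega), smul_zero])]
    refine sum_congr rfl fun m _ => ?_
    rw [← sum_antidiagonal_neg_one_pow_binom k (p - i) m,
      Nat.sum_antidiagonal_eq_sum_range_succ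
        (fun l n => binom k l * (-1) ^ n * binom (p - i + k - l) n), mul_sum, sum_smul]
    refine sum_congr rfl fun l hl => ?_
    rw [mem_range] at hl
    rw [show l + (m - l) = m by omega]
    congr 1
    ring
  rw [sum_comm, sum_congr rfl fun i _ => e i,
    sum_range_sum_range_eq _ le_rfl le_rfl (fun i m him => by rw [hG _ _ him, smul_zero])]
  refine sum_congr rfl fun i _ => ?_
  rw [smul_sum]
  refine sum_congr rfl fun h hh => ?_
  rw [mem_range] at hh
  rw [smul_smul]
  have h1 := binom_mul_binom_add p h (i - h)
  rw [show h + (i - h) = i by omega] at h1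
  have h2 : (-1 : ℂ) ^ h * (-1) ^ (i - h) = (-1) ^ i := by
    rw [← pow_add, show h + (i - h) = i by omega]
  congr 1
  rw [← h2]
  linear_combination ((-1) ^ h * (-1) ^ (i - h)) * h1

/-- For fixed `i` and `s` the sum over `j` is a `k`-th difference of a polynomial of degree `s`,
zero when `s < k`; for `s ≥ k` the vector itself vanishes. -/
theorem sum_binom_smul_eq_zero {W : Type*} [AddCommGroup W] [Module ℂ W] {k M : ℕ}
    (p : ℤ) (G : ℕ → ℕ → W) (hG : ∀ i s, k ≤ s → G i s = 0) :
    ∑ j ∈ range (k + 1), ∑ i ∈ range M, ∑ s ∈ range M,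
      (binom k j * ((-1) ^ i * binom p i) *
        ((-1) ^ j * (-1) ^ i * (-1) ^ s * binom (p + j - i) s)) • G i s = 0 := by
  rw [sum_comm]
  refine sum_eq_zero fun i _ => ?_
  rw [sum_comm]
  refine sum_eq_zero fun s _ => ?_
  rw [← sum_smul]
  by_cases hs : k ≤ s
  · rw [hG _ _ hs, smul_zero]
  · have h := sum_neg_one_pow_binom_eq_zero k (p - i) s (by omega)
    convert zero_smul ℂ (G i s)
    rw [← mul_zero (((-1 : ℂ) ^ i * binom p i) * ((-1) ^ i * (-1) ^ s)), ← h, mul_sum]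
    refine sum_congr rfl fun j _ => ?_
    rw [show p + (j : ℤ) - i = p - i + j by ring]
    ring

/-! ### Vanishing of the commutator defect -/

namespace StateFieldCorrespondence

variable {S : StateFieldCorrespondence V}

theorem eventually_op_eq_zero (a v : V) : ∀ᶠ n : ℤ in Filter.atTop, S.op a n v = 0 := by
  obtain ⟨N, hN⟩ := exists_ncoeff_eq_zero (S.Y a) v
  exact Filter.eventually_atTop.2 ⟨N, hN⟩

theorem eventually_op_op_eq_zero (b c v : V) :
    ∀ᶠ n : ℤ in Filter.atTop, ∀ h : ℕ, S.op (S.op b h c) n v = 0 := by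
  obtain ⟨N, hN⟩ := exists_ncoeff_eq_zero (S.Y b) c
  have h1 := (Filter.eventually_all_finset (range N)).2
    fun h _ => eventually_op_eq_zero (S := S) (S.op b h c) v
  filter_upwards [h1] with n hn h
  by_cases hh : h < N
  · exact hn h (mem_range.2 hh)
  · rw [show S.op b h c = 0 from hN h (by omega), op_zero, LinearMap.zero_apply]

theorem op_sum_sub_sum (A B : Finset ℕ) (f g : ℕ → ℂ) (x y : ℕ → V) (n : ℤ) (v : V) :
    S.op (∑ i ∈ A, f i • x i - ∑ i ∈ B, g i • y i) n v =
      ∑ i ∈ A, f i • S.op (x i) n v - ∑ i ∈ B, g i • S.op (y i) n v := by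
  simp [op, map_sum]

/-- The field-algebra analogue of the Farkas--Letzter identity `[b, c] {a, v} = 0`. -/
theorem IsStrongFieldAlgebra.exists_sum_commutatorDefect (hS : S.IsStrongFieldAlgebra)
    (a b c v : V) (r q : ℤ) :
    ∃ M : ℕ, (∀ i : ℕ, M ≤ i → S.op a i v = 0) ∧ ∀ k : ℕ, M ≤ k →
      ∑ i ∈ range M, ((-1) ^ i * binom (r - k) i) •
        S.commutatorDefect b (r - i) c q (S.op a i v) = 0 := by
  obtain ⟨H, hac, hbc, hav, hbv, haw, hbw, hbcv, hacv⟩ : ∃ H : ℕ,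
      (∀ n : ℤ, H ≤ n → S.op a n c = 0) ∧ (∀ n : ℤ, H ≤ n → S.op b n c = 0) ∧
      (∀ n : ℤ, H ≤ n → S.op a n v = 0) ∧ (∀ n : ℤ, H ≤ n → S.op b n v = 0) ∧
      (∀ n : ℤ, H ≤ n → S.op a n (S.op c q v) = 0) ∧
      (∀ n : ℤ, H ≤ n → S.op b n (S.op c q v) = 0) ∧
      (∀ n : ℤ, H ≤ n → ∀ h : ℕ, S.op (S.op b h c) n v = 0) ∧
      (∀ n : ℤ, H ≤ n → ∀ h : ℕ, S.op (S.op a h c) n v = 0) := by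
    have h := (eventually_op_eq_zero (S := S) a c).and <| (eventually_op_eq_zero (S := S) b c).and <|
      (eventually_op_eq_zero (S := S) a v).and <| (eventually_op_eq_zero (S := S) b v).and <|
      (eventually_op_eq_zero (S := S) a (S.op c q v)).and <|
      (eventually_op_eq_zero (S := S) b (S.op c q v)).and <|
      (eventually_op_op_eq_zero (S := S) b c v).and (eventually_op_op_eq_zero (S := S) a c v)
    obtain ⟨H, hH⟩ := Filter.eventually_atTop.1 h
    refine ⟨H.toNat, ?_⟩
    have hH' : ∀ n : ℤ, (H.toNat : ℤ) ≤ n → H ≤ n := fun n hn => by omega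
    exact ⟨fun n hn => (hH n (hH' n hn)).1, fun n hn => (hH n (hH' n hn)).2.1,
      fun n hn => (hH n (hH' n hn)).2.2.1, fun n hn => (hH n (hH' n hn)).2.2.2.1,
      fun n hn => (hH n (hH' n hn)).2.2.2.2.1, fun n hn => (hH n (hH' n hn)).2.2.2.2.2.1,
      fun n hn => (hH n (hH' n hn)).2.2.2.2.2.2.1, fun n hn => (hH n (hH' n hn)).2.2.2.2.2.2.2⟩
  -- If `h + m ≥ M`, then either `h ≥ H` or `q + m ≥ H`; this choice of `M` makes all truncations
  -- below independent of `k`.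
  obtain ⟨M, hM⟩ : ∃ M : ℕ, M = 2 * H + q.natAbs := ⟨_, rfl⟩
  refine ⟨M, fun i hi => hav i (by omega), fun k hk => ?_⟩
  obtain ⟨p, hp⟩ : ∃ p : ℤ, p = r - k := ⟨_, rfl⟩
  rw [← hp]
  set σ : ℂ := (-1) ^ p with hσ
  have hσ2 : σ * σ = 1 := by rw [hσ, ← mul_zpow]; norm_num
  have hsign : ∀ i : ℕ, (-1 : ℂ) ^ (p - i) = σ * (-1) ^ i := fun i => by
    rw [zpow_sub₀ (by norm_num), zpow_natCast, div_eq_mul_inv, ← inv_pow]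
    norm_num [hσ]
  have hsq : ∀ i : ℕ, (-1 : ℂ) ^ i * (-1) ^ i = 1 := fun i => by rw [← mul_pow]; norm_num
  have hu : ∀ w : V, (∀ n : ℤ, H ≤ n → S.op a n w = 0) → (∀ n : ℤ, H ≤ n → S.op b n w = 0) →
      S.op (S.op a p b) k w =
        -∑ i ∈ range M, (σ * (-1) ^ i * binom p i) • S.op b (r - i) (S.op a i w) := by
    intro w ha hb
    rw [hS.op_op a b p k w (M₁ := 0) (M₂ := M) (fun j _ => hb _ (by omega))
      (fun j hj => ha _ (by omega))]
    simp [hp, hσ]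
  -- These are the three orderings in the expansion of `(u_(j) c)_(k+q-j) v` with `u = a_(p) b`.
  -- `G₂` gives the commutator sum of `b` and `c` on `a_(s) v`, `G₃` gives `b` applied to the
  -- commutator of `a` and `c`, and `G₄` cancels. Terms with `a` leftmost vanish because `k` is
  -- large.
  let G₂ : ℕ → ℕ → V := fun h s => S.op (S.op b h c) (r + q - h - s) (S.op a s v)
  let G₃ : ℕ → ℕ → V := fun h m => S.op b (r - h - m) (S.op (S.op a h c) (q + m) v)
  let G₄ : ℕ → ℕ → V := fun h s => S.op (S.op a h c) (r + q - h - s) (S.op b s v)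
  have hG₂ : ∀ h s, M ≤ h → G₂ h s = 0 := fun h s hh => by
    simp only [G₂]
    rw [hbc h (by omega), op_zero, LinearMap.zero_apply]
  have hG₃ : ∀ h m, M ≤ h + m → G₃ h m = 0 := fun h m hh => by
    simp only [G₃]
    by_cases hH : H ≤ h
    · rw [hac h (by omega), op_zero, LinearMap.zero_apply, map_zero]
    · rw [hacv _ (by omega), map_zero]
  have hG₄ : ∀ h s, k ≤ s → G₄ h s = 0 := fun h s hh => by
    simp only [G₄]
    rw [hbv s (by omega), map_zero]
  have hleft : ∀ i j : ℕ, S.op (S.op a (p - i) (S.op b (j + i) c)) (k + q - j) v =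
      -σ • ∑ s ∈ range M, ((-1) ^ i * ((-1) ^ s * binom (p - i) s)) • G₂ (i + j) s := by
    intro i j
    rw [show (j : ℤ) + i = (i + j : ℕ) by push_cast; ring]
    rw [hS.op_op _ _ _ _ _ (M₁ := 0) (M₂ := M) ?_ (fun s hs => hav _ (by omega))]
    · rw [range_zero, sum_empty, zero_sub, neg_smul, smul_sum, neg_inj]
      refine sum_congr rfl fun s _ => ?_
      rw [smul_smul, hsign,
        show p - (i : ℤ) + (k + q - j) - s = r + q - (i + j : ℕ) - s by push_cast; omega]
      congr 1
      ring
    · intro s _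
      by_cases hh : H ≤ i + j
      · rw [hbc _ (by omega), op_zero, LinearMap.zero_apply]
      · exact hbcv _ (by omega) _
  have hright : ∀ i j : ℕ, j ≤ k → S.op (S.op b (p + j - i) (S.op a i c)) (k + q - j) v =
      ∑ s ∈ range M, ((-1) ^ s * binom (p + j - i) s) • G₃ i (s + (k - j)) -
      σ • ∑ s ∈ range M,
        ((-1) ^ j * (-1) ^ i * (-1) ^ s * binom (p + j - i) s) • G₄ i s := by
    intro i j hj
    rw [hS.op_op _ _ _ _ _ (M₁ := M) (M₂ := M) ?_ (fun s hs => hbv _ (by omega)), smul_sum]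
    · congr 1
      · refine sum_congr rfl fun s _ => ?_
        simp only [G₃]
        rw [show r - (i : ℤ) - (s + (k - j) : ℕ) = p + j - i - s by omega,
          show q + ((s + (k - j) : ℕ) : ℤ) = k + q - j + s by omega]
      · refine sum_congr rfl fun s _ => ?_
        have hz : (-1 : ℂ) ^ (p + j - i) = σ * ((-1) ^ j * (-1) ^ i) := by
          rw [zpow_sub₀ (by norm_num), zpow_add₀ (by norm_num), zpow_natCast, zpow_natCast,
            div_eq_mul_inv, ← inv_pow]
          norm_num [hσ, mul_assoc]
        rw [smul_smul, hz,
          show p + (j : ℤ) - i + (k + q - j) - s = r + q - i - s by omega]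
        congr 1
        ring
    · intro s hs
      exact hacv _ (by omega) _
  have hterm : ∀ j : ℕ, j ≤ k → S.op (S.op (S.op a p b) j c) (k + q - j) v =
      -σ • (∑ i ∈ range M, ∑ s ∈ range M,
        (binom p i * ((-1) ^ s * binom (p - i) s)) • G₂ (i + j) s) -
      σ • (∑ i ∈ range M, ∑ s ∈ range M,
        (((-1) ^ i * binom p i) * ((-1) ^ s * binom (p + j - i) s)) • G₃ i (s + (k - j))) +
      ∑ i ∈ range M, ∑ s ∈ range M, (((-1) ^ i * binom p i) *
        ((-1) ^ j * (-1) ^ i * (-1) ^ s * binom (p + j - i) s)) • G₄ i s := by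
    intro j hj
    rw [hS.op_op a b p j c (M₁ := M) (M₂ := M) (fun i hi => hbc _ (by omega))
      (fun i hi => hac _ (by omega)), op_sum_sub_sum, sub_add]
    congr 1
    · rw [smul_sum]
      refine sum_congr rfl fun i _ => ?_
      rw [hleft, smul_comm, smul_sum]
      congr 1
      refine sum_congr rfl fun s _ => ?_
      rw [smul_smul]
      congr 1
      linear_combination (binom p i * ((-1) ^ s * binom (p - i) s)) * hsq i
    · rw [smul_sum, ← sum_sub_distrib]
      refine sum_congr rfl fun i _ => ?_
      rw [hright i j hj, smul_sub, ← hσ]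
      simp only [smul_sum, smul_smul]
      congr 1
      · refine sum_congr rfl fun s _ => ?_
        congr 1
        ring
      · refine sum_congr rfl fun s _ => ?_
        congr 1
        linear_combination (((-1) ^ i * binom p i) *
          ((-1) ^ j * (-1) ^ i * (-1) ^ s * binom (p + j - i) s)) * hσ2
  -- The formula is already known here because `k ≥ 0`, although the index `p` inside `u` may be
  -- negative.
  have hcomm := LinearMap.congr_fun (hS.commutatorDefect_natCast (S.op a p b) k c q) v
  rw [commutatorDefect, commutatorSum_natCast] at hcomm
  simp only [LinearMap.sub_apply, Module.End.mul_apply, LinearMap.zero_apply,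
    LinearMap.sum_apply, LinearMap.smul_apply] at hcomm
  have hsum : ∑ j ∈ range (k + 1),
      binom k j • S.op (S.op (S.op a p b) j c) (k + q - j) v =
      -σ • (∑ i ∈ range M, ((-1) ^ i * binom p i) •
        ∑ h ∈ range M, binom (r - i) h • G₂ h i) -
      σ • (∑ i ∈ range M, ((-1) ^ i * binom p i) •
        ∑ h ∈ range (i + 1), binom i h • G₃ h (i - h)) := by
    have h2 := sum_binom_smul_regroup_diag (k := k) p G₂ (by omega) hG₂
    have h3 := sum_binom_smul_regroup_reflect (k := k) p G₃ (by omega) hG₃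
    have h4 := sum_binom_smul_eq_zero (M := M) p G₄ hG₄
    rw [show p + (k : ℤ) = r by omega] at h2
    rw [← h2, ← h3, ← add_zero (_ - _), ← h4, smul_sum, smul_sum, ← sum_sub_distrib,
      ← sum_add_distrib]
    refine sum_congr rfl fun j hj => ?_
    rw [mem_range] at hj
    rw [hterm j (by omega), smul_add, smul_sub, smul_comm, smul_comm (binom k j) σ]
    simp only [smul_sum (r := binom k j), smul_smul, mul_assoc]
  rw [hsum, hu v hav hbv, hu _ haw hbw] at hcomm
  have hD : ∀ i ∈ range M, ((-1 : ℂ) ^ i * binom p i) •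
      S.commutatorDefect b (r - i) c q (S.op a i v) =
      ((-1 : ℂ) ^ i * binom p i) • (S.op b (r - i) (S.op a i (S.op c q v)) -
        S.op c q (S.op b (r - i) (S.op a i v)) -
        (∑ h ∈ range M, binom (r - i) h • G₂ h i) -
        ∑ h ∈ range (i + 1), binom i h • G₃ h (i - h)) := by
    intro i _
    congr 1
    have h1 := LinearMap.congr_fun (hS.commutatorDefect_natCast a i c q) v
    rw [commutatorDefect, commutatorSum_natCast] at h1
    simp only [LinearMap.sub_apply, Module.End.mul_apply, LinearMap.zero_apply,
      LinearMap.sum_apply, LinearMap.smul_apply] at h1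
    rw [commutatorDefect, commutatorSum_eq (M := M) (fun j hj => hbc _ (by omega))]
    simp only [LinearMap.sub_apply, Module.End.mul_apply, LinearMap.sum_apply,
      LinearMap.smul_apply]
    have e2 : ∑ h ∈ range M, binom (r - i) h • G₂ h i = ∑ h ∈ range M,
        binom (r - i) h • S.op (S.op b h c) (r - i + q - h) (S.op a i v) := by
      refine sum_congr rfl fun h _ => ?_
      simp only [G₂]
      rw [show r + q - (h : ℤ) - i = r - i + q - h by ring]
    have e3 : ∑ h ∈ range (i + 1), binom i h • G₃ h (i - h) = S.op b (r - i)
        (∑ h ∈ range (i + 1), binom i h • S.op (S.op a h c) (i + q - h) v) := by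
      rw [map_sum]
      refine sum_congr rfl fun h hh => ?_
      rw [mem_range] at hh
      simp only [G₃]
      rw [map_smul, show r - (h : ℤ) - (i - h : ℕ) = r - i by omega,
        show q + ((i - h : ℕ) : ℤ) = i + q - h by omega]
    -- The `G₃` sum is `b_(r-i) [a_(i), c_(q)] v`, valid as `i ≥ 0`; it moves `a_(i)` past `c_(q)`
    -- and leaves `[b_(r-i), c_(q)] a_(i) v`.
    rw [e2, e3, ← sub_eq_zero.1 h1, map_sub]
    abel
  rw [sum_congr rfl hD]
  simp only [smul_sub, sum_sub_distrib]
  have hc : S.op c q (-∑ i ∈ range M, (σ * (-1) ^ i * binom p i) •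
      S.op b (r - i) (S.op a i v)) = -σ • ∑ i ∈ range M, ((-1) ^ i * binom p i) •
      S.op c q (S.op b (r - i) (S.op a i v)) := by
    rw [map_neg, map_sum, neg_smul, smul_sum]
    simp only [map_smul, smul_smul, mul_assoc]
  have hw : -∑ i ∈ range M, (σ * (-1) ^ i * binom p i) •
      S.op b (r - i) (S.op a i (S.op c q v)) = -σ • ∑ i ∈ range M, ((-1) ^ i * binom p i) •
      S.op b (r - i) (S.op a i (S.op c q v)) := by
    rw [neg_smul, smul_sum]
    simp only [smul_smul, mul_assoc]
  rw [hc, hw] at hcomm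
  refine (smul_eq_zero.1 ?_).resolve_left (neg_ne_zero.2 (left_ne_zero_of_mul_eq_one hσ2))
  rw [← hcomm]
  module

theorem IsStrongFieldAlgebra.commutatorDefect_op (hS : S.IsStrongFieldAlgebra)
    (b c : V) (r q : ℤ) (a v : V) (i : ℕ) :
    S.commutatorDefect b r c q (S.op a i v) = 0 := by
  -- The shift to `r + i` makes the `i`-th term carry the mode `r` of `b`.
  obtain ⟨M, hM, h⟩ := hS.exists_sum_commutatorDefect a b c v (r + i) q
  by_cases hi : i < M
  · have := eq_zero_of_eventually_sum_binom_smul M _ (r + i) M h i hi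
    rwa [add_sub_cancel_right] at this
  · rw [hM i (by omega), map_zero]

theorem IsStrongFieldAlgebra.commutatorDefect_op_op (hS : S.IsStrongFieldAlgebra)
    (b c : V) (r q : ℤ) (a f v : V) (m : ℤ) (t : ℕ) :
    S.commutatorDefect b r c q (S.op f m (S.op a t v)) = 0 := by
  obtain ⟨A, hA⟩ := exists_ncoeff_eq_zero (S.Y a) v
  obtain ⟨F, hF⟩ := exists_ncoeff_eq_zero (S.Y f) v
  have h : ∀ k : ℕ, F ≤ k → ∑ j ∈ range A, ((-1) ^ j * binom (m + t - k) j) •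
      S.commutatorDefect b r c q (S.op f (m + t - j) (S.op a j v)) = 0 := by
    intro k hk
    -- The index `m + t - k` keeps the total mode equal to `m + t` for every `k`, so only the
    -- binomial coefficients and a global sign vary with `k`.
    have h1 := hS.commutatorDefect_op b c r q (S.op a (m + t - k) f) v k
    rw [hS.op_op _ _ _ _ _ (M₁ := 0) (M₂ := A) (fun j _ => hF _ (by omega))
      (fun j hj => hA _ (by omega)), range_zero, sum_empty, zero_sub, map_neg, neg_eq_zero] at h1
    simp only [mul_assoc, mul_smul _ (_ * _), ← smul_sum, map_smul, map_sum,
      sub_add_cancel] at h1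
    exact (smul_eq_zero.1 h1).resolve_left (zpow_ne_zero _ (by norm_num))
  by_cases ht : t < A
  · have := eq_zero_of_eventually_sum_binom_smul A _ (m + t) F h t ht
    rwa [add_sub_cancel_right] at this
  · rw [show S.op a t v = 0 from hA _ (by omega), map_zero, map_zero]

theorem IsStrongFieldAlgebra.isVertexAlgebra (hS : S.IsStrongFieldAlgebra) {a c : V} {n : ℕ}
    (h : S.vac = S.mode a n c) : S.IsVertexAlgebra := by
  refine isVertexAlgebra_of_commutatorDefect_eq_zero fun b m d q => ?_
  ext v
  rw [LinearMap.zero_apply, ← S.op_neg_one_vac v, h]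
  obtain ⟨A, hA⟩ := exists_ncoeff_eq_zero (S.Y a) v
  obtain ⟨C, hC⟩ := exists_ncoeff_eq_zero (S.Y c) v
  change S.commutatorDefect b m d q (S.op (S.op a n c) (-1) v) = 0
  rw [hS.op_op _ _ _ _ _ (M₁ := C + n + 2) (M₂ := A) (fun j hj => hC _ (by omega))
    (fun j hj => hA _ (by omega)), map_sub, map_sum, map_sum, sum_eq_zero, sum_eq_zero, sub_zero]
  · intro j _
    rw [map_smul, hS.commutatorDefect_op_op, smul_zero]
  · intro j _
    rw [map_smul]
    -- Here `n ≥ 0` is essential: the binomial vanishes for `j > n`, so only nonnegative outer modes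
    -- of `a` survive.
    by_cases hj : j ≤ n
    · rw [show (n : ℤ) - j = (n - j : ℕ) by omega, hS.commutatorDefect_op, smul_zero]
    · rw [binom_natCast_eq_zero (by omega), mul_zero, zero_smul]

/-! ### Virasoro elements -/

/-- Compare coefficients of `λ^3`; the factor `6` is the `3!` in the definition of the `λ`-product.
-/
theorem IsVirasoroElement.mode_three {l : V} {α : ℂ} (h : S.IsVirasoroElement l α) :
    S.mode l (3 : ℕ) l = (6 * α) • S.vac := by
  have h3 := congrArg (fun x => PolynomialModule.coeff x 3) h
  have h4 : ((3 ! : ℕ) : ℂ)⁻¹ • S.mode l (3 : ℕ) l = α • S.vac := by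
    refine h3.trans ?_
    simp
  rw [mul_smul, ← h4, smul_smul]
  norm_num [Nat.factorial]

end StateFieldCorrespondence

end FieldAlg

end

theorem theorem6p1 {V : Type*} [AddCommGroup V] [Module ℂ V]
    (S : FieldAlg.StateFieldCorrespondence V) (hS : S.IsStrongFieldAlgebra) :
    ((∃ (a c : V) (n : ℕ), S.vac = S.mode a n c) → S.IsVertexAlgebra) ∧
    ((∃ (l : V) (α : ℂ), α ≠ 0 ∧ S.IsVirasoroElement l α) → S.IsVertexAlgebra) := by
  refine ⟨fun ⟨a, c, n, h⟩ => hS.isVertexAlgebra h, fun ⟨l, α, hα, hl⟩ => ?_⟩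
  refine hS.isVertexAlgebra (a := l) (c := (6 * α)⁻¹ • l) (n := 3) ?_
  have h := hl.mode_three
  rw [FieldAlg.StateFieldCorrespondence.mode] at h ⊢
  rw [map_smul, h, inv_smul_smul₀ (mul_ne_zero (by norm_num) hα)]
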